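/- Let $K$ be a compact metrizable topological space with only finitely many accumulation points (possibly none), where $x \in K$ is an accumulation point if every neighbourhood of $x$ contains a point of $K$ other than $x$. Let $C(K)$ be the Banach space of all continuous functions $f : K \to \mathbb{R}$ with the supremum norm, and let $B_{C(K)} = \{ f \in C(K) : \|f\| \le 1 \}$ be its closed unit ball, with the metric $d(f,g) = \|f-g\|$. Then $B_{C(K)}$ is plastic: every bijection $F : B_{C(K)} \to B_{C(K)}$ that is non-expansive, i.e. satisfies $\|F(f)-F(g)\| \le \|f-g\|$ for all $f, g \in B_{C(K)}$, is an isometry, i.e. satisfies $\|F(f)-F(g)\| = \|f-g\|$ for all $f, g \in B_{C(K)}$. -/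

import Mathlib

/-- A metric space `M` is plastic if every non-expansive (that is, `1`-Lipschitz) bijection
of `M` onto itself is an isometry. -/
def IsPlastic (M : Type*) [MetricSpace M] : Prop :=
  ∀ F : M → M, LipschitzWith 1 F → Function.Bijective F → Isometry F

/-! Write `G` for the inverse of `F` and call functions with values ±1 sign functions. Comparing
distances to these extreme points gives `F 0 = 0` and shows that `G` sends sign functions to sign
functions. For `k` in the ball and a sign function `x`, a lower bound on `k * x` is an upper bound
on `‖k - x‖`; hence `F` carries the orthant of `G y` into the orthant of `y` (`le_map_mul`). Since a
square does not inject continuously into a line, flipping `y` at one isolated point flips `G y` at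
exactly one isolated point. This produces a permutation τ of the isolated points, which are dense,
with `G y b = G 1 b * y (τ b)` for sign functions `y`. Finiteness of the set of non-isolated points
makes `G` onto the sign functions (`exists_inv_eq`), and Stone–Weierstrass then shows that
composition with τ and its inverse preserves continuity. Composing `F` with the resulting linear
isometry reduces everything to an `F` that fixes all sign functions, and such an `F` is the
identity.

In that case `F` keeps signs and does not increase moduli pointwise. The engine is
`inv_eq_of_slice`: along a `G`-orbit, successive distances never shrink while the moduli converge
pointwise, so an orbit that moves only at finitely many points is stationary. This criterion is fed
by induction on `FixesLevel`: first modulus one at the non-isolated points, then moduli in `[m, 1 -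
(1 - m) / n]` for growing `n`. These levels exhaust a dense subset of the ball. -/

open Set Filter Topology

/-! ### Isolated and non-isolated points -/

section Topology

variable {K : Type*} [TopologicalSpace K]

theorem continuous_of_continuousAt_nonisolated {f : K → ℝ}
    (h : ∀ p, ¬ IsOpen ({p} : Set K) → ContinuousAt f p) : Continuous f := by
  rw [continuous_iff_continuousAt]
  intro p
  by_cases hp : IsOpen ({p} : Set K)
  · have : 𝓝 p = pure p := by rw [← isOpen_singleton_iff_nhds_eq_pure]; exact hp
    rw [ContinuousAt, this]
    exact tendsto_pure_left.2 fun s hs => mem_of_mem_nhds hs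
  · exact h p hp

theorem dense_isolated [T1Space K] (hfin : {p : K | ¬ IsOpen ({p} : Set K)}.Finite) :
    Dense {a : K | IsOpen ({a} : Set K)} := by
  intro p
  by_cases hp : IsOpen ({p} : Set K)
  · exact subset_closure hp
  · rw [mem_closure_iff]
    intro o ho hpo
    by_contra hne
    apply hp
    have : ({p} : Set K) = o \ ({q | ¬ IsOpen ({q} : Set K)} \ {p}) := by
      ext q
      simp only [mem_singleton_iff, Set.mem_sdiff, mem_ofPred_eq, not_and, not_not]
      constructor
      · rintro rfl
        exact ⟨hpo, fun _ => rfl⟩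
      · rintro ⟨hq, h⟩
        exact h fun hq' => hne ⟨q, hq, hq'⟩
    rw [this]
    exact ho.sdiff (hfin.subset Set.sdiff_subset).isClosed

/-- Near a non-isolated point, isolated points outside a given finite set are dense. -/
theorem mem_closure_isolated_diff [T1Space K] (hfin : {p : K | ¬ IsOpen ({p} : Set K)}.Finite)
    {S : Set K} (hS : S.Finite) {p : K} (hp : ¬ IsOpen ({p} : Set K)) :
    p ∈ closure ({a : K | IsOpen ({a} : Set K)} \ S) := by
  rw [mem_closure_iff]
  intro o ho hpo
  by_contra hne
  apply hp
  have : ({p} : Set K) = o \ (({q | ¬ IsOpen ({q} : Set K)} ∪ S) \ {p}) := by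
    ext q
    simp only [mem_singleton_iff, Set.mem_sdiff, mem_ofPred_eq, not_and, not_not, mem_union]
    constructor
    · rintro rfl
      exact ⟨hpo, fun _ => rfl⟩
    · rintro ⟨hq, h⟩
      by_contra hqp
      have h2 : ¬ (¬ IsOpen ({q} : Set K) ∨ q ∈ S) := fun h3 => hqp (h h3)
      push Not at h2
      exact hne ⟨q, hq, h2.1, h2.2⟩
  rw [this]
  exact ho.sdiff ((hfin.union hS).subset sdiff_subset).isClosed

theorem finite_of_isClosed_of_isolated [CompactSpace K] {s : Set K} (hc : IsClosed s)
    (hs : ∀ a ∈ s, IsOpen ({a} : Set K)) : s.Finite := by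
  have hd : DiscreteTopology s := by
    rw [discreteTopology_iff_isOpen_singleton]
    intro a
    have := (hs a a.2).preimage (continuous_subtype_val : Continuous (Subtype.val : s → K))
    convert this using 1
    ext q
    simp [Subtype.ext_iff]
  exact hc.isCompact.finite ⟨hd⟩

end Topology

/-- There is no continuous injection of a square into the line. -/
theorem not_injOn_square {f : ℝ × ℝ → ℝ} (hf : ContinuousOn f (Icc 0 1 ×ˢ Icc 0 1)) :
    ¬ InjOn f (Icc 0 1 ×ˢ Icc 0 1) := by
  intro hinj
  have h0 : ((0 : ℝ), (0 : ℝ)) ∈ (Icc 0 1 ×ˢ Icc 0 1 : Set (ℝ × ℝ)) := by simp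
  have h1 : ((1 : ℝ), (1 : ℝ)) ∈ (Icc 0 1 ×ˢ Icc 0 1 : Set (ℝ × ℝ)) := by simp
  have hne : f (0, 0) ≠ f (1, 1) := fun h => by
    have := hinj h0 h1 h
    simp at this
  -- The diagonal and the parabola meet only at the two corners, yet `f` takes the mean of its
  -- corner values on both.
  have m1 : MapsTo (fun t : ℝ => (t, t)) (Icc 0 1) (Icc 0 1 ×ˢ Icc 0 1) := fun t ht => ⟨ht, ht⟩
  have m2 : MapsTo (fun t : ℝ => (t, t ^ 2)) (Icc 0 1) (Icc 0 1 ×ˢ Icc 0 1) := fun t ht =>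
    ⟨ht, by positivity, by nlinarith [ht.1, ht.2]⟩
  have c1 : ContinuousOn (fun t : ℝ => f (t, t)) (uIcc 0 1) := by
    rw [uIcc_of_le zero_le_one]
    exact hf.comp (by fun_prop) m1
  have c2 : ContinuousOn (fun t : ℝ => f (t, t ^ 2)) (uIcc 0 1) := by
    rw [uIcc_of_le zero_le_one]
    exact hf.comp (by fun_prop) m2
  have hc : (f (0, 0) + f (1, 1)) / 2 ∈ uIcc (f (0, 0)) (f (1, 1)) := by
    rw [mem_uIcc]
    rcases le_total (f (0, 0)) (f (1, 1)) with h | h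
    · left; constructor <;> linarith
    · right; constructor <;> linarith
  obtain ⟨t, ht, ht'⟩ := intermediate_value_uIcc c1 hc
  obtain ⟨s, hs, hs'⟩ := intermediate_value_uIcc c2 (by simpa using hc)
  rw [uIcc_of_le zero_le_one] at ht hs
  have e := hinj (m1 ht) (m2 hs) (ht'.trans hs'.symm)
  simp only [Prod.mk.injEq] at e
  obtain ⟨rfl, e2⟩ := e
  have : t = 0 ∨ t = 1 := by
    have : t * (t - 1) = 0 := by nlinarith
    rcases mul_eq_zero.1 this with h | h
    · exact Or.inl h
    · right; linarith
  apply hne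
  rcases this with rfl | rfl <;> simp only at ht' <;> linarith

/-! ### Continuous functions and sign functions -/

section Functions

variable {K : Type*} [TopologicalSpace K]

/-- The function `f` with its value at the isolated point `a` changed to `v`. -/
noncomputable def ContinuousMap.updateAt [T1Space K] (f : C(K, ℝ)) (a : K)
    (ha : IsOpen ({a} : Set K)) (v : ℝ) : C(K, ℝ) :=
  ⟨fun q => open Classical in if q = a then v else f q, by
    apply continuous_of_continuousAt_nonisolated
    intro p hp
    have hpa : p ≠ a := by rintro rfl; exact hp ha
    refine f.continuous.continuousAt.congr ?_
    filter_upwards [isOpen_ne.mem_nhds hpa] with q hq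
    rw [if_neg hq]⟩

theorem ContinuousMap.updateAt_self [T1Space K] (f : C(K, ℝ)) (a : K)
    (ha : IsOpen ({a} : Set K)) (v : ℝ) : f.updateAt a ha v a = v := by
  simp [ContinuousMap.updateAt]

theorem ContinuousMap.updateAt_of_ne [T1Space K] (f : C(K, ℝ)) {a q : K}
    (ha : IsOpen ({a} : Set K)) (v : ℝ) (h : q ≠ a) : f.updateAt a ha v q = f q := by
  simp [ContinuousMap.updateAt, h]

/-- `x` takes only the values `1` and `-1`. -/
def IsSign (x : C(K, ℝ)) : Prop := ∀ q, x q * x q = 1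

theorem IsSign.eq_or {x : C(K, ℝ)} (hx : IsSign x) (q : K) : x q = 1 ∨ x q = -1 :=
  mul_self_eq_one_iff.1 (hx q)

theorem IsSign.abs {x : C(K, ℝ)} (hx : IsSign x) (q : K) : |x q| = 1 := by
  rcases hx.eq_or q with h | h <;> simp [h]

theorem IsSign.neg {x : C(K, ℝ)} (hx : IsSign x) : IsSign (-x) := fun q => by
  simpa using hx q

theorem IsSign.mul {x y : C(K, ℝ)} (hx : IsSign x) (hy : IsSign y) : IsSign (x * y) := fun q => by
  simp only [ContinuousMap.mul_apply]
  calc x q * y q * (x q * y q) = (x q * x q) * (y q * y q) := by ring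
    _ = 1 := by rw [hx q, hy q, one_mul]

theorem isSign_one : IsSign (1 : C(K, ℝ)) := fun q => by simp

theorem IsSign.eq_neg_of_ne {x y : C(K, ℝ)} (hx : IsSign x) (hy : IsSign y) {q : K}
    (h : x q ≠ y q) : y q = - x q := by
  rcases hx.eq_or q with h1 | h1 <;> rcases hy.eq_or q with h2 | h2 <;> simp_all

theorem IsSign.updateAt [T1Space K] {x : C(K, ℝ)} (hx : IsSign x) {a : K}
    (ha : IsOpen ({a} : Set K)) : IsSign (x.updateAt a ha (-x a)) := fun q => by
  by_cases h : q = a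
  · subst h
    rw [ContinuousMap.updateAt_self]
    simpa using hx q
  · rw [ContinuousMap.updateAt_of_ne _ _ _ h]
    exact hx q

theorem IsSign.norm_le [CompactSpace K] {x : C(K, ℝ)} (hx : IsSign x) : ‖x‖ ≤ 1 :=
  (ContinuousMap.norm_le _ zero_le_one).2 fun q => by rw [Real.norm_eq_abs, hx.abs]

theorem norm_le_iff_abs [CompactSpace K] {f : C(K, ℝ)} {r : ℝ} (hr : 0 ≤ r) :
    ‖f‖ ≤ r ↔ ∀ q, |f q| ≤ r := by
  simp [ContinuousMap.norm_le _ hr]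

theorem norm_sub_le_iff_abs [CompactSpace K] {f g : C(K, ℝ)} {r : ℝ} (hr : 0 ≤ r) :
    ‖f - g‖ ≤ r ↔ ∀ q, |f q - g q| ≤ r := by
  simp [ContinuousMap.norm_le _ hr]

theorem abs_apply_le [CompactSpace K] {f : C(K, ℝ)} {r : ℝ} (h : ‖f‖ ≤ r) (q : K) :
    |f q| ≤ r := (f.norm_coe_le_norm q).trans h

theorem abs_sub_apply_le [CompactSpace K] {f g : C(K, ℝ)} {r : ℝ} (h : ‖f - g‖ ≤ r) (q : K) :
    |f q - g q| ≤ r := ((f - g).norm_coe_le_norm q).trans h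

theorem eq_of_dense_eq {s : Set K} (hs : Dense s) {f g : C(K, ℝ)} (h : ∀ a ∈ s, f a = g a) :
    f = g := by
  apply DFunLike.coe_injective
  exact f.continuous.ext_on hs g.continuous h

theorem norm_le_of_dense [CompactSpace K] {s : Set K} (hs : Dense s) {f : C(K, ℝ)} {r : ℝ}
    (hr : 0 ≤ r) (h : ∀ a ∈ s, |f a| ≤ r) : ‖f‖ ≤ r := by
  rw [norm_le_iff_abs hr]
  intro q
  have hc : IsClosed {q | |f q| ≤ r} := isClosed_le (by fun_prop) continuous_const
  have := hc.closure_subset_iff.2 (show s ⊆ {q | |f q| ≤ r} from h)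
  exact this (hs q)

/-- A function that vanishes at no non-isolated point has a continuous sign. -/
theorem exists_isSign_mul_eq_abs {k : C(K, ℝ)} (hk : ∀ p, ¬ IsOpen ({p} : Set K) → k p ≠ 0) :
    ∃ x : C(K, ℝ), IsSign x ∧ (∀ q, k q * x q = |k q|) ∧
      ∀ q, (0 ≤ k q → x q = 1) ∧ (k q < 0 → x q = -1) := by
  refine ⟨⟨fun q => if 0 ≤ k q then 1 else -1, ?_⟩, ?_, ?_, ?_⟩
  · apply continuous_of_continuousAt_nonisolated
    intro p hp
    rcases lt_or_gt_of_ne (hk p hp) with h | h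
    · refine (continuousAt_const (y := (-1 : ℝ))).congr ?_
      filter_upwards [k.continuous.continuousAt.eventually (gt_mem_nhds h)] with q hq
      rw [if_neg (not_le.2 hq)]
    · refine (continuousAt_const (y := (1 : ℝ))).congr ?_
      filter_upwards [k.continuous.continuousAt.eventually (lt_mem_nhds h)] with q hq
      rw [if_pos hq.le]
  · intro q
    simp only [ContinuousMap.coe_mk]
    split_ifs <;> simp
  · intro q
    simp only [ContinuousMap.coe_mk]
    split_ifs with h
    · simp [abs_of_nonneg h]
    · simp [abs_of_neg (not_le.1 h)]
  · intro q
    simp only [ContinuousMap.coe_mk]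
    exact ⟨fun h => if_pos h, fun h => if_neg (not_le.2 h)⟩

end Functions

/-! ### Orthants and extreme points under a non-expansive bijection -/

/-- `F` is a non-expansive bijection of the closed unit ball of `C(K, ℝ)`, with inverse `G`. -/
structure NonexpansiveBij {K : Type*} [TopologicalSpace K] [CompactSpace K]
    (F G : C(K, ℝ) → C(K, ℝ)) : Prop where
  norm_map : ∀ f, ‖f‖ ≤ 1 → ‖F f‖ ≤ 1
  norm_inv : ∀ f, ‖f‖ ≤ 1 → ‖G f‖ ≤ 1
  map_inv : ∀ f, ‖f‖ ≤ 1 → F (G f) = f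
  inv_map : ∀ f, ‖f‖ ≤ 1 → G (F f) = f
  dist_le : ∀ f g, ‖f‖ ≤ 1 → ‖g‖ ≤ 1 → ‖F f - F g‖ ≤ ‖f - g‖

namespace NonexpansiveBij

variable {K : Type*} [TopologicalSpace K] [CompactSpace K] {F G : C(K, ℝ) → C(K, ℝ)}

theorem le_dist_inv (H : NonexpansiveBij F G) {f g : C(K, ℝ)} (hf : ‖f‖ ≤ 1) (hg : ‖g‖ ≤ 1) :
    ‖f - g‖ ≤ ‖G f - G g‖ := by
  have := H.dist_le _ _ (H.norm_inv f hf) (H.norm_inv g hg)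
  rwa [H.map_inv f hf, H.map_inv g hg] at this

theorem map_injective (H : NonexpansiveBij F G) {f g : C(K, ℝ)} (hf : ‖f‖ ≤ 1) (hg : ‖g‖ ≤ 1)
    (h : F f = F g) : f = g := by
  rw [← H.inv_map f hf, h, H.inv_map g hg]

theorem inv_injective (H : NonexpansiveBij F G) {f g : C(K, ℝ)} (hf : ‖f‖ ≤ 1) (hg : ‖g‖ ≤ 1)
    (h : G f = G g) : f = g := by
  rw [← H.map_inv f hf, h, H.map_inv g hg]

theorem abs_sub_le (H : NonexpansiveBij F G) {f g : C(K, ℝ)} (hf : ‖f‖ ≤ 1) (hg : ‖g‖ ≤ 1)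
    {r : ℝ} (hr : 0 ≤ r) (h : ∀ q, |f q - g q| ≤ r) (q : K) : |F f q - F g q| ≤ r :=
  abs_sub_apply_le ((H.dist_le f g hf hg).trans ((norm_sub_le_iff_abs hr).2 h)) q

theorem tendsto_map (H : NonexpansiveBij F G) {u : ℕ → C(K, ℝ)} {k : C(K, ℝ)}
    (hu : ∀ n, ‖u n‖ ≤ 1) (hk : ‖k‖ ≤ 1) (h : Tendsto u atTop (𝓝 k)) :
    Tendsto (fun n => F (u n)) atTop (𝓝 (F k)) := by
  rw [tendsto_iff_norm_sub_tendsto_zero] at h ⊢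
  exact squeeze_zero (fun _ => norm_nonneg _) (fun n => H.dist_le _ _ (hu n) hk) h

/-- Everything in the ball is within one of `0`, so `F 0` is within one of both constants `1` and
`-1`. -/
theorem map_zero (H : NonexpansiveBij F G) : F 0 = 0 := by
  have h0 : ‖(0 : C(K, ℝ))‖ ≤ 1 := by simp
  have key : ∀ y : C(K, ℝ), IsSign y → ∀ q, |y q - F 0 q| ≤ 1 := by
    intro y hy q
    have := H.abs_sub_le (H.norm_inv y hy.norm_le) h0 zero_le_one
      (fun q => by simpa using abs_apply_le (H.norm_inv y hy.norm_le) q) q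
    rwa [H.map_inv y hy.norm_le] at this
  ext q
  have h1 := abs_le.1 (key 1 isSign_one q)
  have h2 := abs_le.1 (key (-1) isSign_one.neg q)
  simp only [ContinuousMap.one_apply, ContinuousMap.neg_apply] at h1 h2
  simp only [ContinuousMap.zero_apply]
  linarith [h1.1, h1.2, h2.1, h2.2]

theorem norm_map_le (H : NonexpansiveBij F G) {f : C(K, ℝ)} (hf : ‖f‖ ≤ 1) : ‖F f‖ ≤ ‖f‖ := by
  simpa [H.map_zero] using H.dist_le f 0 hf (by simp)

/-- Sign functions, the extreme points of the ball, are only images of sign functions. -/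
theorem isSign_inv (H : NonexpansiveBij F G) {y : C(K, ℝ)} (hy : IsSign y) : IsSign (G y) := by
  set x := G y with hx
  have hxn : ‖x‖ ≤ 1 := H.norm_inv y hy.norm_le
  have hxa := fun q => abs_le.1 (abs_apply_le hxn q)
  -- Only `y / 2` has norm at most 1/2 and lies within 1/2 of `y`.
  have key : ∀ z : C(K, ℝ), (∀ q, |z q| ≤ 1 / 2) → (∀ q, |x q - z q| ≤ 1 / 2) →
      ‖z‖ ≤ 1 ∧ F z = (1 / 2 : ℝ) • y := by
    intro z hz hxz
    have hzn : ‖z‖ ≤ 1 / 2 := (norm_le_iff_abs (by norm_num)).2 hz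
    have hz1 : ‖z‖ ≤ 1 := hzn.trans (by norm_num)
    refine ⟨hz1, ?_⟩
    ext q
    have e1 := abs_le.1 (abs_apply_le ((H.norm_map_le hz1).trans hzn) q)
    have e2 := abs_le.1 (H.abs_sub_le hxn hz1 (by norm_num) hxz q)
    rw [hx, H.map_inv y hy.norm_le] at e2
    simp only [ContinuousMap.smul_apply, smul_eq_mul]
    rcases hy.eq_or q with h | h <;> rw [h] at e2 ⊢ <;> linarith [e1.1, e1.2, e2.1, e2.2]
  -- A second candidate besides `x / 2`; the two agree exactly where `|x| = 1`.
  let w : C(K, ℝ) := (1 / 2 : ℝ) • (x + (1 - ⟨fun q => |x q|, by fun_prop⟩))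
  have hw : ∀ q, w q = 1 / 2 * (x q + (1 - |x q|)) := fun q => by simp [w]; ring
  have h1 := key ((1 / 2 : ℝ) • x)
    (fun q => by
      simp only [ContinuousMap.smul_apply, smul_eq_mul]
      rw [abs_le]; constructor <;> linarith [(hxa q).1, (hxa q).2])
    (fun q => by
      simp only [ContinuousMap.smul_apply, smul_eq_mul]
      rw [abs_le]; constructor <;> linarith [(hxa q).1, (hxa q).2])
  have h2 := key w
    (fun q => by
      rw [hw, abs_le]
      rcases abs_cases (x q) with h | h <;> constructor <;> linarith [(hxa q).1, (hxa q).2])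
    (fun q => by
      rw [hw, abs_le]
      rcases abs_cases (x q) with h | h <;> constructor <;> linarith [(hxa q).1, (hxa q).2])
  have e := H.map_injective h1.1 h2.1 (h1.2.trans h2.2.symm)
  intro q
  have eq := congrArg (fun f : C(K, ℝ) => f q) e
  simp only [hw, ContinuousMap.smul_apply, smul_eq_mul] at eq
  have : |x q| = 1 := by linarith
  rw [← abs_mul_abs_self, this, one_mul]

/-- The midpoint of `G y` and `G (-y)` is within one of both, so its image is within one of `y` and
`-y`, hence zero; injectivity makes the midpoint zero. -/
theorem inv_neg (H : NonexpansiveBij F G) {y : C(K, ℝ)} (hy : IsSign y) : G (-y) = -G y := by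
  have hx := H.isSign_inv hy
  have hx' := H.isSign_inv hy.neg
  have hb : ∀ q, |((1 / 2 : ℝ) • (G y + G (-y))) q| ≤ 1 := fun q => by
    simp only [ContinuousMap.smul_apply, ContinuousMap.add_apply, smul_eq_mul]
    rcases hx.eq_or q with h | h <;> rcases hx'.eq_or q with h' | h' <;> rw [h, h'] <;> norm_num
  have hn := (norm_le_iff_abs zero_le_one).2 hb
  have h1 := H.abs_sub_le hn hx.norm_le zero_le_one fun q => by
    simp only [ContinuousMap.smul_apply, ContinuousMap.add_apply, smul_eq_mul]
    rcases hx.eq_or q with h | h <;> rcases hx'.eq_or q with h' | h' <;> rw [h, h'] <;> norm_num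
  have h2 := H.abs_sub_le hn hx'.norm_le zero_le_one fun q => by
    simp only [ContinuousMap.smul_apply, ContinuousMap.add_apply, smul_eq_mul]
    rcases hx.eq_or q with h | h <;> rcases hx'.eq_or q with h' | h' <;> rw [h, h'] <;> norm_num
  rw [H.map_inv _ hy.norm_le] at h1
  rw [H.map_inv _ hy.neg.norm_le] at h2
  have h0 : F ((1 / 2 : ℝ) • (G y + G (-y))) = F 0 := by
    rw [H.map_zero]
    ext q
    have e1 := abs_le.1 (h1 q)
    have e2 := abs_le.1 (h2 q)
    simp only [ContinuousMap.neg_apply] at e2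
    simp only [ContinuousMap.zero_apply]
    rcases hy.eq_or q with h | h <;> rw [h] at e1 e2 <;> linarith [e1.1, e1.2, e2.1, e2.2]
  have e := H.map_injective hn (by simp) h0
  ext q
  have eq := congrArg (fun f : C(K, ℝ) => f q) e
  simp only [ContinuousMap.smul_apply, ContinuousMap.add_apply, smul_eq_mul,
    ContinuousMap.zero_apply] at eq
  simp only [ContinuousMap.neg_apply]
  linarith

/-- Lower bounds on `k * G y` pass to `F k * y`, for a sign function `y`. -/
theorem le_map_mul (H : NonexpansiveBij F G) {y k : C(K, ℝ)} (hy : IsSign y) (hk : ‖k‖ ≤ 1)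
    {m : ℝ} (h : ∀ q, m ≤ k q * G y q) (q : K) : m ≤ F k q * y q := by
  have hx := H.isSign_inv hy
  have hka := fun q => abs_le.1 (abs_apply_le hk q)
  have hm : 0 ≤ 1 - m := by
    have h1 := h q
    have h2 := hka q
    rcases hx.eq_or q with e | e <;> rw [e] at h1 <;> linarith [h2.1, h2.2]
  -- Where `x = ±1` and `|k| ≤ 1`, one has `|k - x| = 1 - k * x`.
  have := H.abs_sub_le hk hx.norm_le hm (fun q => by
    have h1 := h q
    have h2 := hka q
    rw [abs_le]
    rcases hx.eq_or q with e | e <;> rw [e] at h1 ⊢ <;> constructor <;> linarith [h2.1, h2.2]) q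
  rw [H.map_inv _ hy.norm_le] at this
  have := abs_le.1 this
  rcases hy.eq_or q with e | e <;> rw [e] at this ⊢ <;> linarith [this.1, this.2]

/-- Sign functions that differ at a single isolated point have preimages that differ at a single
isolated point. -/
theorem exists_inv_updateAt (H : NonexpansiveBij F G) [T2Space K] {y : C(K, ℝ)} (hy : IsSign y)
    {a : K} (ha : IsOpen ({a} : Set K)) :
    ∃ b, IsOpen ({b} : Set K) ∧ ∀ q,
      (q = b → G (y.updateAt a ha (-y a)) q = -G y q) ∧
      (q ≠ b → G (y.updateAt a ha (-y a)) q = G y q) := by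
  set y' := y.updateAt a ha (-y a) with hy'def
  have hy' : IsSign y' := hy.updateAt ha
  have hx := H.isSign_inv hy
  have hx' := H.isSign_inv hy'
  set x := G y with hxdef
  set x' := G y' with hx'def
  have hy'a : y' a = -y a := ContinuousMap.updateAt_self _ _ _ _
  have hy'q : ∀ q, q ≠ a → y' q = y q := fun q hq => ContinuousMap.updateAt_of_ne _ _ _ hq
  have hya : y a ≠ 0 := fun h => by simpa [h] using hy a
  have hne : ∃ b, x b ≠ x' b := by
    by_contra! hcon
    have : x = x' := ContinuousMap.ext hcon
    have := H.inv_injective hy.norm_le hy'.norm_le this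
    have h2 := congrArg (fun f : C(K, ℝ) => f a) this
    simp only [hy'a] at h2
    exact hya (by linarith)
  obtain ⟨b, hb⟩ := hne
  have huniq : ∀ c, x c ≠ x' c → c = b := by
    intro c hc
    by_contra hcb
    obtain ⟨φ, hφ0, hφ1, hφ⟩ := exists_continuous_zero_one_of_isClosed (isClosed_singleton (x := b))
      (isClosed_singleton (x := c)) (by simpa using Ne.symm hcb)
    have hφb : φ b = 0 := hφ0 rfl
    have hφc : φ c = 1 := hφ1 rfl
    -- A square of functions in the common orthant of `x` and `-x'`; the parameters can be read off
    -- at `b` and `c`.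
    let k : ℝ × ℝ → C(K, ℝ) := fun u => ((1 / 2 : ℝ) • (x - x')) * (u.1 • (1 - φ) + u.2 • φ)
    have hk : ∀ u q, k u q = 1 / 2 * (x q - x' q) * (u.1 * (1 - φ q) + u.2 * φ q) :=
      fun u q => by simp [k]; ring
    have hg : ∀ u ∈ (Icc 0 1 ×ˢ Icc 0 1 : Set (ℝ × ℝ)), ∀ q,
        0 ≤ u.1 * (1 - φ q) + u.2 * φ q ∧ u.1 * (1 - φ q) + u.2 * φ q ≤ 1 := by
      rintro ⟨u, v⟩ ⟨hu, hv⟩ q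
      simp only [mem_Icc] at hu hv ⊢
      have := hφ q
      constructor
      · have := mul_nonneg hu.1 (sub_nonneg.2 this.2)
        have := mul_nonneg hv.1 (hφ q).1
        linarith
      · nlinarith [this.1, this.2]
    have hkn : ∀ u ∈ (Icc 0 1 ×ˢ Icc 0 1 : Set (ℝ × ℝ)), ‖k u‖ ≤ 1 := by
      intro u hu
      rw [norm_le_iff_abs zero_le_one]
      intro q
      have := hg u hu q
      rw [hk, abs_le]
      rcases hx.eq_or q with e | e <;> rcases hx'.eq_or q with e' | e' <;> rw [e, e'] <;>
        constructor <;> linarith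
    -- The images lie in the orthants of both `y` and `-y'`, which are opposite away from `a`.
    have hval : ∀ u ∈ (Icc 0 1 ×ˢ Icc 0 1 : Set (ℝ × ℝ)), ∀ q, q ≠ a → F (k u) q = 0 := by
      intro u hu q hq
      have h1 := H.le_map_mul hy (hkn u hu) (m := 0) (fun q => by
        have := hg u hu q
        rw [hk, ← hxdef]
        rcases hx.eq_or q with e | e <;> rcases hx'.eq_or q with e' | e' <;> rw [e, e'] <;>
          linarith) q
      have h2 := H.le_map_mul hy'.neg (hkn u hu) (m := 0) (fun q => by
        have := hg u hu q
        rw [hk, H.inv_neg hy', ContinuousMap.neg_apply, ← hx'def]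
        rcases hx.eq_or q with e | e <;> rcases hx'.eq_or q with e' | e' <;> rw [e, e'] <;>
          linarith) q
      rw [ContinuousMap.neg_apply, hy'q q hq] at h2
      rcases hy.eq_or q with e | e <;> rw [e] at h1 h2 <;> linarith
    have hcont : ContinuousOn (fun u => F (k u) a) (Icc 0 1 ×ˢ Icc 0 1) := by
      have hkc : Continuous k := by fun_prop
      have hF : ContinuousOn F {f | ‖f‖ ≤ 1} := by
        have : LipschitzOnWith 1 F {f | ‖f‖ ≤ 1} := LipschitzOnWith.of_dist_le_mul
          fun f hf g hg => by simpa [dist_eq_norm] using H.dist_le f g hf hg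
        exact this.continuousOn
      have := hF.comp hkc.continuousOn (fun u hu => hkn u hu)
      exact (continuous_eval_const (F := C(K, ℝ)) a).comp_continuousOn this
    refine not_injOn_square hcont ?_
    intro u hu v hv huv
    have : F (k u) = F (k v) := by
      ext q
      by_cases hq : q = a
      · rw [hq]; exact huv
      · rw [hval u hu q hq, hval v hv q hq]
    have hkk := H.map_injective (hkn u hu) (hkn v hv) this
    have e1 := congrArg (fun f : C(K, ℝ) => f b) hkk
    have e2 := congrArg (fun f : C(K, ℝ) => f c) hkk
    simp only [hk, hφb, hφc] at e1 e2
    have n1 : 1 / 2 * (x b - x' b) ≠ 0 := mul_ne_zero (by norm_num) (sub_ne_zero.2 hb)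
    have n2 : 1 / 2 * (x c - x' c) ≠ 0 := mul_ne_zero (by norm_num) (sub_ne_zero.2 hc)
    have f1 := mul_left_cancel₀ n1 e1
    have f2 := mul_left_cancel₀ n2 e2
    ext <;> linarith
  refine ⟨b, ?_, fun q => ⟨?_, ?_⟩⟩
  · have : ({b} : Set K) = {q | x q ≠ x' q} := by
      ext q
      exact ⟨fun h => by rw [mem_singleton_iff.1 h]; exact hb, fun h => huniq q h⟩
    rw [this]
    exact isOpen_ne_fun (by fun_prop) (by fun_prop)
  · rintro rfl
    exact hx.eq_neg_of_ne hx' hb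
  · intro hq
    by_contra h
    exact hq (huniq q (Ne.symm h))

end NonexpansiveBij

/-! ### Point masses and the permutation of the isolated points -/

namespace NonexpansiveBij

variable {K : Type*} [TopologicalSpace K] [CompactSpace K] {F G : C(K, ℝ) → C(K, ℝ)}

/-- The image of a signed point mass in the orthant of `G y` is a signed point mass in the orthant
of `y`. -/
theorem exists_map_single (H : NonexpansiveBij F G) [T2Space K]
    (hd : Dense {a : K | IsOpen ({a} : Set K)}) {y : C(K, ℝ)} (hy : IsSign y)
    {b : K} (hb : IsOpen ({b} : Set K)) :
    ∃ a, IsOpen ({a} : Set K) ∧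
      0 < F ((0 : C(K, ℝ)).updateAt b hb (G y b)) a * y a ∧
      ∀ a', IsOpen ({a'} : Set K) →
        F ((0 : C(K, ℝ)).updateAt b hb (G y b)) a' ≠ 0 → a' = a := by
  have hx := H.isSign_inv hy
  set k := (0 : C(K, ℝ)).updateAt b hb (G y b) with hkdef
  have hkb : k b = G y b := ContinuousMap.updateAt_self _ _ _ _
  have hkq : ∀ q, q ≠ b → k q = 0 := fun q hq => by
    rw [hkdef, ContinuousMap.updateAt_of_ne _ _ _ hq, ContinuousMap.zero_apply]
  have hkx : ∀ q, q ≠ b → k q * G y q = 0 := fun q hq => by rw [hkq q hq, zero_mul]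
  have hkn : ‖k‖ ≤ 1 := by
    rw [norm_le_iff_abs zero_le_one]
    intro q
    by_cases hq : q = b
    · rw [hq, hkb, hx.abs]
    · rw [hkq q hq]; simp
  have hpos : ∀ q, 0 ≤ F k q * y q := H.le_map_mul hy hkn fun q => by
    by_cases hq : q = b
    · rw [hq, hkb, hx b]; exact zero_le_one
    · rw [hkx q hq]
  -- If the flip happened away from `b`, then `k` would stay in the flipped orthant, forcing `F k a
  -- * y a ≤ 0`.
  have key : ∀ a (ha : IsOpen ({a} : Set K)), F k a ≠ 0 →
      ∀ q, (q = b → G (y.updateAt a ha (-y a)) q = -G y q) ∧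
        (q ≠ b → G (y.updateAt a ha (-y a)) q = G y q) := by
    intro a ha hne
    obtain ⟨c, -, hc⟩ := H.exists_inv_updateAt hy ha
    have hcb : c = b := by
      by_contra hcb
      have := H.le_map_mul (hy.updateAt ha) hkn (m := 0) (fun q => by
        by_cases hq : q = b
        · rw [hq, (hc b).2 (Ne.symm hcb), hkb, hx b]; exact zero_le_one
        · rw [hkq q hq, zero_mul]) a
      rw [ContinuousMap.updateAt_self] at this
      have h0 : F k a * y a = 0 := le_antisymm (by linarith) (hpos a)
      rcases mul_eq_zero.1 h0 with h | h
      · exact hne h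
      · simpa [h] using hy a
    rwa [hcb] at hc
  have hex : ∃ a, IsOpen ({a} : Set K) ∧ F k a ≠ 0 := by
    by_contra! hcon
    have h0 : F k = F 0 := by
      rw [H.map_zero]
      exact eq_of_dense_eq hd hcon
    have := congrArg (fun f : C(K, ℝ) => f b) (H.map_injective hkn (by simp) h0)
    simp only [hkb, ContinuousMap.zero_apply] at this
    simpa [this] using hx b
  obtain ⟨a, ha, hne⟩ := hex
  refine ⟨a, ha, ?_, fun a' ha' hne' => ?_⟩
  · refine lt_of_le_of_ne (hpos a) fun h => ?_
    rcases mul_eq_zero.1 h.symm with h | h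
    · exact hne h
    · simpa [h] using hy a
  · by_contra haa
    have e : G (y.updateAt a ha (-y a)) = G (y.updateAt a' ha' (-y a')) := by
      ext q
      by_cases hq : q = b
      · rw [(key a ha hne q).1 hq, (key a' ha' hne' q).1 hq]
      · rw [(key a ha hne q).2 hq, (key a' ha' hne' q).2 hq]
    have e2 := congrArg (fun f : C(K, ℝ) => f a)
      (H.inv_injective (hy.updateAt ha).norm_le (hy.updateAt ha').norm_le e)
    simp only [ContinuousMap.updateAt_self, ContinuousMap.updateAt_of_ne _ _ _ (Ne.symm haa)] at e2
    have : y a = 0 := by linarith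
    simpa [this] using hy a

/-- On sign functions, `G` is a signed composition with a permutation of the isolated points. -/
theorem exists_perm_inv_apply (H : NonexpansiveBij F G) [T2Space K]
    (hd : Dense {a : K | IsOpen ({a} : Set K)}) :
    ∃ τ : Equiv.Perm {a : K // IsOpen ({a} : Set K)},
      ∀ y : C(K, ℝ), IsSign y → ∀ b : {a : K // IsOpen ({a} : Set K)},
        G y b = G 1 b * y (τ b) := by
  have hx1 := H.isSign_inv isSign_one
  choose t ht using fun b : {a : K // IsOpen ({a} : Set K)} =>
    H.exists_map_single hd isSign_one b.2
  let τ : {a : K // IsOpen ({a} : Set K)} → {a : K // IsOpen ({a} : Set K)} :=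
    fun b => ⟨t b, (ht b).1⟩
  -- For `y` and for `1` the point mass at `b` is then the same function, so its image has the sign
  -- of both at `τ b`.
  have key0 : ∀ y : C(K, ℝ), IsSign y → ∀ b : {a : K // IsOpen ({a} : Set K)},
      G y b = G 1 b → y (τ b) = 1 := by
    intro y hy b e
    obtain ⟨a, ha, hpos, -⟩ := H.exists_map_single hd hy b.2
    rw [e] at hpos
    have hat : a = t b := (ht b).2.2 a ha fun h => by rw [h, zero_mul] at hpos; exact hpos.ne rfl
    have h1 := (ht b).2.1
    rw [hat] at hpos
    rw [ContinuousMap.one_apply, mul_one] at h1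
    have : 0 < y (t b) := pos_of_mul_pos_right hpos h1.le
    rcases hy.eq_or (t b) with h | h
    · exact h
    · rw [h] at this; norm_num at this
  have key : ∀ y : C(K, ℝ), IsSign y → ∀ b : {a : K // IsOpen ({a} : Set K)},
      G y b = G 1 b * y (τ b) := by
    intro y hy b
    by_cases e : G y b = G 1 b
    · rw [key0 y hy b e, mul_one, e]
    · have e' := (H.isSign_inv hy).eq_neg_of_ne hx1 e
      have := key0 (-y) hy.neg b (by rw [H.inv_neg hy, e', ContinuousMap.neg_apply])
      rw [ContinuousMap.neg_apply] at this
      rw [e', show y (τ b) = -1 by linarith]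
      ring
  -- Flipping `1` at `a` changes its preimage only at `c` by `exists_inv_updateAt`, and exactly on
  -- the fibre of `a` by `key`.
  have hflip : ∀ a : {a : K // IsOpen ({a} : Set K)}, ∃ c : {a : K // IsOpen ({a} : Set K)},
      ∀ b, τ b = a ↔ b = c := by
    intro a
    obtain ⟨c, hc, h⟩ := H.exists_inv_updateAt isSign_one a.2
    refine ⟨⟨c, hc⟩, fun b => ?_⟩
    have hk := key _ (isSign_one.updateAt a.2) b
    have hb := hx1 b
    constructor
    · intro hba
      rw [hba, ContinuousMap.updateAt_self] at hk
      by_contra hbc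
      rw [(h b).2 fun hh => hbc (Subtype.ext hh)] at hk
      simp only [ContinuousMap.one_apply] at hk
      have : G 1 (b : K) = 0 := by linarith
      simp [this] at hb
    · rintro rfl
      by_contra hba
      rw [(h c).1 rfl, ContinuousMap.updateAt_of_ne _ _ _ (fun hh => hba (Subtype.ext hh))] at hk
      simp only [ContinuousMap.one_apply] at hk
      have : G 1 c = 0 := by linarith
      simp [this] at hb
  have hbij : Function.Bijective τ := by
    constructor
    · intro b b' hbb
      obtain ⟨c, hc⟩ := hflip (τ b)
      rw [(hc b).1 rfl, (hc b').1 hbb.symm]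
    · intro a
      obtain ⟨c, hc⟩ := hflip a
      exact ⟨c, (hc c).2 rfl⟩
  exact ⟨Equiv.ofBijective τ hbij, key⟩

end NonexpansiveBij

/-! ### Sign functions modulo finite changes, and continuity of the permutation -/

section Signs

variable {K : Type*} [TopologicalSpace K]

/-- Two sign functions agree at the non-isolated points iff they differ at finitely many isolated
points. -/
theorem finite_ne_iff [CompactSpace K] [T1Space K]
    (hfin : {p : K | ¬ IsOpen ({p} : Set K)}.Finite) {x y : C(K, ℝ)} (hx : IsSign x)
    (hy : IsSign y) :
    {b : {a : K // IsOpen ({a} : Set K)} | x b ≠ y b}.Finite ↔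
      ∀ p, ¬ IsOpen ({p} : Set K) → x p = y p := by
  constructor
  · intro h p hp
    have hcl : IsClosed {q | x q = y q} := isClosed_eq (by fun_prop) (by fun_prop)
    have hS := h.image (Subtype.val)
    have hsub : {a : K | IsOpen ({a} : Set K)} \ (Subtype.val ''
        {b : {a : K // IsOpen ({a} : Set K)} | x b ≠ y b}) ⊆ {q | x q = y q} := by
      rintro q ⟨hq, hq'⟩
      by_contra hne
      exact hq' ⟨⟨q, hq⟩, hne, rfl⟩
    exact hcl.closure_subset_iff.2 hsub (mem_closure_isolated_diff hfin hS hp)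
  · intro h
    -- The disagreement set is also `{x = -y}`, hence a compact set of isolated points.
    have hcl : IsClosed {q | x q ≠ y q} := by
      have : {q | x q ≠ y q} = {q | x q = - y q} := by
        ext q
        constructor
        · intro hq
          have := hx.eq_neg_of_ne hy hq
          simp only [mem_ofPred_eq, this, neg_neg]
        · intro hq hq'
          simp only [mem_ofPred_eq] at hq
          have : y q = 0 := by linarith
          simpa [this] using hy q
      rw [this]
      exact isClosed_eq (by fun_prop) (by fun_prop)
    have hf := finite_of_isClosed_of_isolated hcl fun a ha => by
      by_contra hna
      exact ha (h a hna)
    exact hf.preimage Subtype.val_injective.injOn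

/-- Changing the sign at finitely many isolated points. -/
theorem exists_isSign_flip [T1Space K] {y : C(K, ℝ)} (hy : IsSign y)
    {S : Set {a : K // IsOpen ({a} : Set K)}} (hS : S.Finite) :
    ∃ z : C(K, ℝ), IsSign z ∧ ∀ b, (b ∈ S → z b = -y b) ∧ (b ∉ S → z b = y b) := by
  classical
  have hS' := hS.image (Subtype.val : {a : K // IsOpen ({a} : Set K)} → K)
  refine ⟨⟨fun q => if q ∈ Subtype.val '' S then -y q else y q, ?_⟩, ?_, ?_⟩
  · apply continuous_of_continuousAt_nonisolated
    intro p hp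
    refine y.continuous.continuousAt.congr ?_
    have hpS : p ∉ Subtype.val '' S := by
      rintro ⟨b, -, rfl⟩
      exact hp b.2
    filter_upwards [hS'.isClosed.isOpen_compl.mem_nhds hpS] with q hq
    rw [if_neg hq]
  · intro q
    simp only [ContinuousMap.coe_mk]
    split_ifs
    · simpa using hy q
    · exact hy q
  · intro b
    simp only [ContinuousMap.coe_mk]
    exact ⟨fun h => if_pos ⟨b, h, rfl⟩, fun h => if_neg fun ⟨c, hc, e⟩ => h (Subtype.ext e ▸ hc)⟩

/-- If composition with a permutation of the isolated points preserves sign functions, it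
preserves continuous functions. -/
theorem exists_eq_comp_perm [CompactSpace K] [T2Space K]
    (hfin : {p : K | ¬ IsOpen ({p} : Set K)}.Finite)
    (τ : Equiv.Perm {a : K // IsOpen ({a} : Set K)})
    (hτ : ∀ x : C(K, ℝ), IsSign x → ∃ z : C(K, ℝ), ∀ b : {a : K // IsOpen ({a} : Set K)},
      z b = x (τ b)) (k : C(K, ℝ)) :
    ∃ h : C(K, ℝ), ∀ b : {a : K // IsOpen ({a} : Set K)}, h b = k (τ b) := by
  let A : Subalgebra ℝ C(K, ℝ) :=
    { carrier := {k | ∃ h : C(K, ℝ), ∀ b : {a : K // IsOpen ({a} : Set K)}, h b = k (τ b)}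
      mul_mem' := by
        rintro f g ⟨f', hf⟩ ⟨g', hg⟩
        exact ⟨f' * g', fun b => by simp [hf, hg]⟩
      add_mem' := by
        rintro f g ⟨f', hf⟩ ⟨g', hg⟩
        exact ⟨f' + g', fun b => by simp [hf, hg]⟩
      algebraMap_mem' := fun r => ⟨algebraMap ℝ C(K, ℝ) r, fun b => by simp⟩ }
  have hsep : A.SeparatesPoints := by
    intro p q hpq
    obtain ⟨φ, hφ0, hφ1, -⟩ := exists_continuous_zero_one_of_isClosed
      (isClosed_singleton (x := p)) (isClosed_singleton (x := q)) (by simpa using hpq)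
    have hφp : φ p = 0 := hφ0 rfl
    have hφq : φ q = 1 := hφ1 rfl
    -- A threshold missing the values of `φ` at the non-isolated points, so that the sign of `φ - c`
    -- is continuous and separates `p` from `q`.
    obtain ⟨c, hc, hcn⟩ := (Ioo_infinite (zero_lt_one (α := ℝ))).exists_notMem_finset
      (hfin.image φ).toFinset
    rw [Finite.mem_toFinset] at hcn
    obtain ⟨x, hx, -, hxs⟩ := exists_isSign_mul_eq_abs
      (k := φ - ContinuousMap.const K c) (fun r hr h0 => hcn ⟨r, hr, by
        simp only [ContinuousMap.sub_apply, ContinuousMap.const_apply] at h0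
        linarith⟩)
    refine ⟨x, ⟨x, hτ x hx, rfl⟩, ?_⟩
    rw [(hxs p).2 (by simp [hφp, hc.1]), (hxs q).1 (by simp [hφq, hc.2.le])]
    norm_num
  have hdense := ContinuousMap.subalgebra_topologicalClosure_eq_top_of_separatesPoints A hsep
  have hdi := dense_isolated hfin
  have hclosed : IsClosed (A : Set C(K, ℝ)) := by
    refine isClosed_of_closure_subset fun f hf => ?_
    obtain ⟨u, hu, hlim⟩ := mem_closure_iff_seq_limit.1 hf
    choose v hv using hu
    -- The isolated points are dense, so they determine the sup norm and the transported sequence is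
    -- again Cauchy.
    have hle : ∀ m n, dist (v m) (v n) ≤ dist (u m) (u n) := by
      intro m n
      rw [dist_eq_norm, dist_eq_norm]
      refine norm_le_of_dense hdi (norm_nonneg _) fun a ha => ?_
      have := (u m - u n).norm_coe_le_norm (τ ⟨a, ha⟩)
      simpa [hv m ⟨a, ha⟩, hv n ⟨a, ha⟩] using this
    have hcv : CauchySeq v := by
      have hcu := hlim.cauchySeq
      rw [Metric.cauchySeq_iff'] at hcu ⊢
      intro ε hε
      obtain ⟨N, hN⟩ := hcu ε hε
      exact ⟨N, fun n hn => (hle n N).trans_lt (hN n hn)⟩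
    obtain ⟨g, hg⟩ := cauchySeq_tendsto_of_complete hcv
    refine ⟨g, fun b => ?_⟩
    have h1 : Tendsto (fun n => v n b) atTop (𝓝 (g b)) :=
      ((continuous_eval_const (F := C(K, ℝ)) (b : K)).tendsto g).comp hg
    have h2 : Tendsto (fun n => u n (τ b)) atTop (𝓝 (f (τ b))) :=
      ((continuous_eval_const (F := C(K, ℝ)) (τ b : K)).tendsto f).comp hlim
    refine tendsto_nhds_unique h1 (h2.congr fun n => (hv n b).symm)
  have : k ∈ A.topologicalClosure := by rw [hdense]; trivial
  rwa [← SetLike.mem_coe, Subalgebra.topologicalClosure_coe, hclosed.closure_eq] at this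

end Signs

/-- Modulo changes at finitely many isolated points there are only finitely many sign functions. `G`
acts injectively on these classes, hence surjectively, and the finite discrepancy is repaired
through τ. -/
theorem NonexpansiveBij.exists_inv_eq {K : Type*} [TopologicalSpace K] [CompactSpace K] [T2Space K]
    {F G : C(K, ℝ) → C(K, ℝ)} (H : NonexpansiveBij F G)
    (hfin : {p : K | ¬ IsOpen ({p} : Set K)}.Finite) {x : C(K, ℝ)} (hx : IsSign x) :
    ∃ y : C(K, ℝ), IsSign y ∧ G y = x := by
  have hd := dense_isolated hfin
  obtain ⟨τ, hτ⟩ := H.exists_perm_inv_apply hd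
  have hx1 := H.isSign_inv isSign_one
  have hx1' : ∀ q, G 1 q ≠ 0 := fun q h => by simpa [h] using hx1 q
  let r : C(K, ℝ) → Set K := fun x => {p | ¬ IsOpen ({p} : Set K) ∧ x p = 1}
  have hr : ∀ x y : C(K, ℝ), IsSign x → IsSign y → (r x = r y ↔
      {b : {a : K // IsOpen ({a} : Set K)} | x b ≠ y b}.Finite) := by
    intro x y hx hy
    rw [finite_ne_iff hfin hx hy]
    constructor
    · intro h p hp
      have := Set.ext_iff.1 h p
      simp only [r, mem_ofPred_eq, hp, not_false_eq_true, true_and] at this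
      rcases hx.eq_or p with e | e <;> rcases hy.eq_or p with e' | e' <;> rw [e, e'] at this ⊢ <;>
        norm_num at this
    · intro h
      ext p
      simp only [r, mem_ofPred_eq]
      exact and_congr_right fun hp => by rw [h p hp]
  have hrG : ∀ y z : C(K, ℝ), IsSign y → IsSign z → (r (G y) = r (G z) ↔ r y = r z) := by
    intro y z hy hz
    rw [hr _ _ (H.isSign_inv hy) (H.isSign_inv hz), hr _ _ hy hz]
    have : {b : {a : K // IsOpen ({a} : Set K)} | G y b ≠ G z b} =
        τ ⁻¹' {b : {a : K // IsOpen ({a} : Set K)} | y b ≠ z b} := by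
      ext b
      simp only [mem_ofPred_eq, mem_preimage]
      rw [hτ y hy, hτ z hz, ne_eq, mul_right_inj' (hx1' b)]
    rw [this]
    exact ⟨fun h => by simpa using h.of_preimage τ.surjective, fun h => h.preimage τ.injective.injOn⟩
  let R : Set (Set K) := r '' {x | IsSign x}
  have hR : R.Finite := by
    refine hfin.finite_subsets.subset ?_
    rintro _ ⟨x, -, rfl⟩
    exact fun p hp => hp.1
  have hch : ∀ s ∈ R, ∃ y : C(K, ℝ), IsSign y ∧ r y = s := fun s hs => hs
  choose! c hc using hch
  have hmaps : MapsTo (fun s => r (G (c s))) R R := fun s hs =>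
    ⟨_, H.isSign_inv (hc s hs).1, rfl⟩
  have hinj : InjOn (fun s => r (G (c s))) R := by
    intro s hs s' hs' h
    have := (hrG _ _ (hc s hs).1 (hc s' hs').1).1 h
    rwa [(hc s hs).2, (hc s' hs').2] at this
  have hsurj := ((hR.injOn_iff_bijOn_of_mapsTo hmaps).1 hinj).surjOn
  obtain ⟨s, hs, hse⟩ := hsurj (⟨x, hx, rfl⟩ : r x ∈ R)
  have hcs := (hc s hs).1
  have hT := (hr _ _ (H.isSign_inv hcs) hx).1 hse
  obtain ⟨z, hz, hz'⟩ := exists_isSign_flip hcs (hT.image τ)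
  refine ⟨z, hz, eq_of_dense_eq hd fun a ha => ?_⟩
  have h1 := hτ z hz ⟨a, ha⟩
  have h2 := hτ _ hcs ⟨a, ha⟩
  simp only at h1 h2
  by_cases hax : G (c s) a = x a
  · rw [(hz' _).2 (by
      rintro ⟨b, hb, e⟩
      rw [τ.injective e] at hb
      exact hb hax), ← h2, hax] at h1
    exact h1
  · rw [(hz' _).1 ⟨⟨a, ha⟩, hax, rfl⟩, mul_neg, ← h2] at h1
    rw [h1, (H.isSign_inv hcs).eq_neg_of_ne hx hax]

/-! ### Dense families in the ball -/

theorem exists_tendsto_of_forall_norm_sub_le {K : Type*} [TopologicalSpace K] [CompactSpace K]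
    {p : C(K, ℝ) → Prop} {k : C(K, ℝ)} (h : ∀ η : ℝ, 0 < η → ∃ f, p f ∧ ‖f - k‖ ≤ η) :
    ∃ u : ℕ → C(K, ℝ), (∀ n, p (u n)) ∧ Tendsto u atTop (𝓝 k) := by
  choose u hu using fun n : ℕ => h (1 / ((n : ℝ) + 1)) (by positivity)
  refine ⟨u, fun n => (hu n).1, ?_⟩
  rw [tendsto_iff_norm_sub_tendsto_zero]
  exact squeeze_zero (fun _ => norm_nonneg _) (fun n => (hu n).2)
    tendsto_one_div_add_atTop_nhds_zero_nat

/-- Functions of norm less than one without zeros among the non-isolated points are dense in the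
ball. -/
theorem exists_nonvanishing_norm_sub_le {K : Type*} [TopologicalSpace K] [CompactSpace K]
    (hfin : {p : K | ¬ IsOpen ({p} : Set K)}.Finite) {k : C(K, ℝ)} (hk : ‖k‖ ≤ 1)
    {η : ℝ} (hη : 0 < η) :
    ∃ f : C(K, ℝ), (‖f‖ < 1 ∧ ∀ p, ¬ IsOpen ({p} : Set K) → f p ≠ 0) ∧ ‖f - k‖ ≤ η := by
  set δ := min (η / 2) (1 / 2) with hδ
  have hδ0 : 0 < δ := by positivity
  have hδ1 : δ ≤ η / 2 := min_le_left _ _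
  have hδ2 : δ ≤ 1 / 2 := min_le_right _ _
  have hka := fun q => abs_le.1 (abs_apply_le hk q)
  -- Scaling by `1 - δ` leaves room for a shift by `c < δ / 2`, chosen to avoid the finitely many
  -- shifts that create a zero.
  obtain ⟨c, hc, hcn⟩ := (Ioo_infinite (half_pos hδ0)).exists_notMem_finset
    (hfin.image (fun p => -((1 - δ) * k p))).toFinset
  rw [Finite.mem_toFinset] at hcn
  have hf : ∀ q, ((1 - δ) • k + ContinuousMap.const K c) q = (1 - δ) * k q + c := fun q => by simp
  refine ⟨(1 - δ) • k + ContinuousMap.const K c, ⟨?_, ?_⟩, ?_⟩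
  · refine lt_of_le_of_lt (b := 1 - δ / 2) ?_ (by linarith)
    rw [norm_le_iff_abs (by linarith)]
    intro q
    rw [hf, abs_le]
    constructor <;> nlinarith [(hka q).1, (hka q).2, hc.1, hc.2]
  · intro p hp h0
    rw [hf] at h0
    exact hcn ⟨p, hp, by simp only; linarith⟩
  · rw [norm_sub_le_iff_abs hη.le]
    intro q
    rw [hf, abs_le]
    constructor <;> nlinarith [(hka q).1, (hka q).2, hc.1, hc.2]

/-- A positive lower bound for a function that vanishes at no non-isolated point. -/
theorem exists_pos_le_abs {K : Type*} [TopologicalSpace K]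
    (hfin : {p : K | ¬ IsOpen ({p} : Set K)}.Finite) {k : C(K, ℝ)}
    (hk : ∀ p, ¬ IsOpen ({p} : Set K) → k p ≠ 0) :
    ∃ m : ℝ, 0 < m ∧ m ≤ 1 ∧ ∀ p, ¬ IsOpen ({p} : Set K) → m ≤ |k p| := by
  rcases eq_empty_or_nonempty {p : K | ¬ IsOpen ({p} : Set K)} with he | hne
  · exact ⟨1, one_pos, le_rfl, fun p hp => absurd hp (eq_empty_iff_forall_notMem.1 he p)⟩
  · obtain ⟨p, hp, hmin⟩ := exists_min_image _ (fun p => |k p|) hfin hne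
    exact ⟨min |k p| 1, lt_min (abs_pos.2 (hk p hp)) one_pos, min_le_right _ _,
      fun q hq => (min_le_left _ _).trans (hmin q hq)⟩

/-! ### Bijections fixing the sign functions -/

/-- A non-expansive bijection of the ball that fixes all sign functions. -/
structure NonexpansiveFixingSigns {K : Type*} [TopologicalSpace K] [CompactSpace K]
    (F G : C(K, ℝ) → C(K, ℝ)) : Prop extends NonexpansiveBij F G where
  map_sign : ∀ x, IsSign x → F x = x
  finite_nonisolated : {p : K | ¬ IsOpen ({p} : Set K)}.Finite

namespace NonexpansiveFixingSigns

variable {K : Type*} [TopologicalSpace K] [CompactSpace K] {F G : C(K, ℝ) → C(K, ℝ)}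

theorem inv_sign (H : NonexpansiveFixingSigns F G) {x : C(K, ℝ)} (hx : IsSign x) : G x = x := by
  conv_lhs => rw [← H.map_sign x hx]
  exact H.inv_map x hx.norm_le

/-- When `k` has a continuous sign `x`, comparison with `x` gives the sign of `F k`, and comparison
with `x` flipped at an isolated point bounds the modulus there. Density gives the rest. -/
theorem map_mul_nonneg_and_abs_le (H : NonexpansiveFixingSigns F G) [T2Space K] {k : C(K, ℝ)}
    (hk : ‖k‖ ≤ 1) (q : K) : 0 ≤ F k q * k q ∧ |F k q| ≤ |k q| := by
  have hd := dense_isolated H.finite_nonisolated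
  have hcl : ∀ f g : C(K, ℝ), IsClosed {q | 0 ≤ f q * g q ∧ |f q| ≤ |g q|} := fun f g => by
    have h1 : IsClosed {q | 0 ≤ f q * g q} := isClosed_le continuous_const (by fun_prop)
    have h2 : IsClosed {q | |f q| ≤ |g q|} := isClosed_le (by fun_prop) (by fun_prop)
    exact h1.inter h2
  have key : ∀ f : C(K, ℝ), ‖f‖ ≤ 1 → (∀ p, ¬ IsOpen ({p} : Set K) → f p ≠ 0) →
      ∀ a, IsOpen ({a} : Set K) → 0 ≤ F f a * f a ∧ |F f a| ≤ |f a| := by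
    intro f hf hf0 a ha
    obtain ⟨x, hx, hfx, -⟩ := exists_isSign_mul_eq_abs hf0
    have h1 := H.le_map_mul hx hf (m := 0) (fun q => by
      rw [H.inv_sign hx, hfx]; exact abs_nonneg _) a
    have h2 := H.le_map_mul (hx.updateAt ha) hf (m := -|f a|) (fun q => by
      rw [H.inv_sign (hx.updateAt ha)]
      by_cases hq : q = a
      · rw [hq, ContinuousMap.updateAt_self, ← hfx]; linarith
      · rw [ContinuousMap.updateAt_of_ne _ _ _ hq, hfx]
        linarith [abs_nonneg (f a), abs_nonneg (f q)]) a
    rw [ContinuousMap.updateAt_self] at h2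
    have h3 := hfx a
    have h4 : F f a * f a = (F f a * x a) * |f a| := by
      rw [← h3]
      calc F f a * f a = F f a * f a * (x a * x a) := by rw [hx a, mul_one]
        _ = _ := by ring
    have h5 : |F f a| = F f a * x a := by
      rw [← abs_of_nonneg h1, abs_mul, hx.abs, mul_one]
    exact ⟨by rw [h4]; positivity, by rw [h5]; linarith⟩
  obtain ⟨u, hu, hlim⟩ := exists_tendsto_of_forall_norm_sub_le
    (fun η hη => exists_nonvanishing_norm_sub_le H.finite_nonisolated hk hη)
  have hlim' := H.tendsto_map (fun n => (hu n).1.le) hk hlim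
  have hiso : {a : K | IsOpen ({a} : Set K)} ⊆ {q | 0 ≤ F k q * k q ∧ |F k q| ≤ |k q|} := by
    intro a ha
    have l1 : Tendsto (fun n => u n a) atTop (𝓝 (k a)) :=
      ((continuous_eval_const (F := C(K, ℝ)) a).tendsto k).comp hlim
    have l2 : Tendsto (fun n => F (u n) a) atTop (𝓝 (F k a)) :=
      ((continuous_eval_const (F := C(K, ℝ)) a).tendsto (F k)).comp hlim'
    have hk' := fun n => key (u n) (hu n).1.le (hu n).2 a ha
    exact ⟨ge_of_tendsto' (l2.mul l1) fun n => (hk' n).1,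
      le_of_tendsto_of_tendsto' l2.abs l1.abs fun n => (hk' n).2⟩
  exact (hcl _ _).closure_subset_iff.2 hiso (hd q)

theorem abs_le_abs_inv (H : NonexpansiveFixingSigns F G) [T2Space K] {h : C(K, ℝ)}
    (hh : ‖h‖ ≤ 1) (q : K) : 0 ≤ h q * G h q ∧ |h q| ≤ |G h q| := by
  have := H.map_mul_nonneg_and_abs_le (H.norm_inv h hh) q
  rwa [H.map_inv h hh] at this

theorem map_eq_of_inv_eq (H : NonexpansiveFixingSigns F G) {h : C(K, ℝ)} (hh : ‖h‖ ≤ 1)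
    (e : G h = h) : F h = h := by
  conv_lhs => rw [← e]
  exact H.map_inv h hh

theorem map_eq_of_approx (H : NonexpansiveFixingSigns F G) {k : C(K, ℝ)} (hk : ‖k‖ ≤ 1)
    (h : ∀ η : ℝ, 0 < η → ∃ f, (‖f‖ ≤ 1 ∧ F f = f) ∧ ‖f - k‖ ≤ η) : F k = k := by
  obtain ⟨u, hu, hlim⟩ := exists_tendsto_of_forall_norm_sub_le h
  have hlim' := H.tendsto_map (fun n => (hu n).1) hk hlim
  exact tendsto_nhds_unique (hlim'.congr fun n => (hu n).2) hlim

/-- If `G` does not change, outside a finite set, any function agreeing with `h` there, then it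
fixes `h`. -/
theorem inv_eq_of_slice (H : NonexpansiveFixingSigns F G) [T2Space K] {h : C(K, ℝ)}
    (hh : ‖h‖ ≤ 1) {S : Set K} (hS : S.Finite)
    (hslice : ∀ f : C(K, ℝ), ‖f‖ ≤ 1 → (∀ q ∉ S, f q = h q) → ∀ q ∉ S, G f q = f q) :
    G h = h := by
  let u : ℕ → C(K, ℝ) := fun n => G^[n] h
  have hsucc : ∀ n, u (n + 1) = G (u n) := fun n => Function.iterate_succ_apply' G n h
  have hun : ∀ n, ‖u n‖ ≤ 1 := by
    intro n
    induction n with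
    | zero => exact hh
    | succ n ih => rw [hsucc]; exact H.norm_inv _ ih
  have huS : ∀ n, ∀ q ∉ S, u n q = h q := by
    intro n
    induction n with
    | zero => exact fun _ _ => rfl
    | succ n ih => intro q hq; rw [hsucc, hslice _ (hun n) ih q hq, ih q hq]
  -- `G` is non-contractive, being inverse to `F`.
  have hgrow : ∀ n, ‖u 1 - u 0‖ ≤ ‖u (n + 1) - u n‖ := by
    intro n
    induction n with
    | zero => exact le_rfl
    | succ n ih =>
      rw [hsucc (n + 1), hsucc n]
      refine ih.trans ?_
      have := H.le_dist_inv (hun (n + 1)) (hun n)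
      rwa [hsucc n] at this ⊢
  -- Moduli increase along the orbit and signs persist, so the values themselves converge.
  have hconv : ∀ q, Tendsto (fun n => |u (n + 1) q - u n q|) atTop (𝓝 0) := by
    intro q
    have hmono : Monotone fun n => |u n q| := monotone_nat_of_le_succ fun n => by
      rw [hsucc]; exact (H.abs_le_abs_inv (hun n) q).2
    have hbdd : BddAbove (range fun n => |u n q|) := ⟨1, by
      rintro _ ⟨n, rfl⟩
      exact abs_apply_le (hun n) q⟩
    have hl := tendsto_atTop_ciSup hmono hbdd
    have := (hl.comp (tendsto_add_atTop_nat 1)).sub hl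
    rw [sub_self] at this
    refine this.congr fun n => ?_
    have := H.abs_le_abs_inv (hun n) q
    rw [← hsucc] at this
    simp only [Function.comp]
    generalize u (n + 1) q = s at *
    generalize u n q = t at *
    obtain ⟨h1, h2⟩ := this
    rcases lt_trichotomy t 0 with ht | ht | ht
    · have : s ≤ 0 := by
        by_contra! hs
        nlinarith
      rw [abs_of_nonpos this, abs_of_neg ht] at *
      rw [abs_of_nonpos (by linarith)]
      ring
    · simp [ht]
    · have : 0 ≤ s := by
        by_contra! hs
        nlinarith
      rw [abs_of_nonneg this, abs_of_pos ht] at *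
      rw [abs_of_nonneg (by linarith)]
  have hle : ∀ ε : ℝ, 0 < ε → ‖u 1 - u 0‖ ≤ ε := by
    intro ε hε
    have hev : ∀ᶠ n in atTop, ∀ q ∈ S, |u (n + 1) q - u n q| ≤ ε :=
      (eventually_all_finite hS).2 fun q _ => (hconv q).eventually (ge_mem_nhds hε)
    obtain ⟨n, hn⟩ := hev.exists
    refine (hgrow n).trans ((norm_sub_le_iff_abs hε.le).2 fun q => ?_)
    by_cases hq : q ∈ S
    · exact hn q hq
    · rw [huS (n + 1) q hq, huS n q hq, sub_self, abs_zero]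
      exact hε.le
  have h0 : ‖u 1 - u 0‖ ≤ 0 := le_of_forall_pos_le_add fun ε hε => by
    simpa using hle ε hε
  exact sub_eq_zero.1 (norm_le_zero_iff.1 h0)

/-- A slice criterion that only looks at moduli at isolated points. -/
theorem inv_eq_of_slice_abs (H : NonexpansiveFixingSigns F G) [T2Space K] {h : C(K, ℝ)}
    (hh : ‖h‖ ≤ 1) {S : Set K} (hS : S.Finite)
    (hslice : ∀ f : C(K, ℝ), ‖f‖ ≤ 1 → (∀ q ∉ S, f q = h q) →
      ∀ a ∉ S, IsOpen ({a} : Set K) → |G f a| ≤ |f a|) :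
    G h = h := by
  refine H.inv_eq_of_slice hh hS fun f hf hfS => ?_
  have hiso : ∀ a ∉ S, IsOpen ({a} : Set K) → G f a = f a := by
    intro a haS ha
    have h1 := H.abs_le_abs_inv hf a
    have h2 := le_antisymm (hslice f hf hfS a haS ha) h1.2
    rcases abs_eq_abs.1 h2 with e | e
    · exact e
    · have h3 := h1.1
      rw [e] at h3 ⊢
      have : f a = 0 := by nlinarith [mul_self_nonneg (f a)]
      rw [this, neg_zero]
  intro q hq
  by_cases hqo : IsOpen ({q} : Set K)
  · exact hiso q hq hqo
  · have hcl : IsClosed {q | G f q = f q} := isClosed_eq (by fun_prop) (by fun_prop)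
    exact hcl.closure_subset_iff.2 (fun a ha => hiso a ha.2 ha.1)
      (mem_closure_isolated_diff H.finite_nonisolated hS hqo)

/-- Functions of modulus one at the non-isolated points are fixed. -/
theorem map_eq_of_abs_eq_one (H : NonexpansiveFixingSigns F G) [T2Space K] {k : C(K, ℝ)}
    (hk : ‖k‖ ≤ 1) (hk1 : ∀ p, ¬ IsOpen ({p} : Set K) → |k p| = 1) : F k = k := by
  refine H.map_eq_of_approx hk fun η hη => ?_
  obtain ⟨x, hx, hkx, -⟩ := exists_isSign_mul_eq_abs (k := k) fun p hp h0 => by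
    have := hk1 p hp
    rw [h0, abs_zero] at this
    exact zero_ne_one this
  -- Pushing moduli up by `η` makes them one off a finite set, where `G` has no room to increase
  -- them.
  let h : C(K, ℝ) := x * ⟨fun q => min 1 (|k q| + η), by fun_prop⟩
  have hh : ∀ q, h q = x q * min 1 (|k q| + η) := fun q => rfl
  have habs : ∀ q, |h q| = min 1 (|k q| + η) := fun q => by
    rw [hh, abs_mul, hx.abs, one_mul, abs_of_nonneg]
    positivity
  have hn : ‖h‖ ≤ 1 := (norm_le_iff_abs zero_le_one).2 fun q => by
    rw [habs]; exact min_le_left _ _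
  have hkeq : ∀ q, k q = x q * |k q| := fun q => by
    rw [← hkx, mul_comm (k q), ← mul_assoc, hx q, one_mul]
  refine ⟨h, ⟨hn, H.map_eq_of_inv_eq hn ?_⟩, ?_⟩
  · have hcl : IsClosed {q | |k q| ≤ 1 - η} := isClosed_le (by fun_prop) continuous_const
    have hSI : ∀ a ∈ {q | |k q| ≤ 1 - η}, IsOpen ({a} : Set K) := fun a ha => by
      by_contra hna
      have := hk1 a hna
      simp only [mem_ofPred_eq] at ha
      linarith
    refine H.inv_eq_of_slice_abs hn (finite_of_isClosed_of_isolated hcl hSI)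
      fun f hf hfS a ha _ => ?_
    rw [hfS a ha, habs]
    simp only [mem_ofPred_eq, not_le] at ha
    rw [min_eq_left (by linarith)]
    exact abs_apply_le (H.norm_inv f hf) a
  · rw [norm_sub_le_iff_abs hη.le]
    intro q
    have hk1 := abs_apply_le hk q
    have e : h q - k q = x q * (min 1 (|k q| + η) - |k q|) := by
      rw [mul_sub, ← hkeq q, hh]
    rw [e, abs_mul, hx.abs, one_mul, abs_le]
    rcases min_cases 1 (|k q| + η) with m | m <;> rw [m.1] <;> constructor <;> linarith

end NonexpansiveFixingSigns

/-! ### Induction on the gap below modulus one -/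

namespace NonexpansiveFixingSigns

variable {K : Type*} [TopologicalSpace K] [CompactSpace K] {F G : C(K, ℝ) → C(K, ℝ)}

/-- `F` fixes the functions whose moduli at the non-isolated points are at least `m` and stay
below one by at least `(1 - m) / n`. -/
def FixesLevel (F : C(K, ℝ) → C(K, ℝ)) (n : ℕ) : Prop :=
  ∀ (m : ℝ) (k : C(K, ℝ)), 0 < m → m ≤ 1 → ‖k‖ ≤ 1 →
    (∀ p, ¬ IsOpen ({p} : Set K) → m ≤ |k p| ∧ 1 - m ≤ n * (1 - |k p|)) → F k = k

theorem fixesLevel_zero (H : NonexpansiveFixingSigns F G) [T2Space K] : FixesLevel F 0 := by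
  intro m k _ hm1 hk h
  refine H.map_eq_of_abs_eq_one hk fun p hp => le_antisymm (abs_apply_le hk p) ?_
  have := h p hp
  simp only [Nat.cast_zero, zero_mul] at this
  linarith

/-- Some `g` within `d` of `k` is fixed at level `n` and has modulus `min 1 (|k a| + d)` at `a`;
non-expansiveness loses at most `d`. -/
theorem min_abs_le_abs_map (H : NonexpansiveFixingSigns F G) [T2Space K] {n : ℕ}
    (hF : FixesLevel F n) {m d : ℝ} (hm : 0 < m) (hm1 : m ≤ 1) (hd : (n + 1) * d = 1 - m)
    {k : C(K, ℝ)} (hk : ‖k‖ ≤ 1) (hkm : ∀ p, ¬ IsOpen ({p} : Set K) → m ≤ |k p|)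
    {a : K} (ha : IsOpen ({a} : Set K)) : min |k a| (1 - d) ≤ |F k a| := by
  have hn : (0 : ℝ) ≤ n := n.cast_nonneg
  have hd0 : 0 ≤ d := by
    by_contra! h
    nlinarith
  have hnd : n * d < 1 := by nlinarith
  have hnd0 : 0 ≤ n * d := by positivity
  obtain ⟨x, hx, hkx, -⟩ := exists_isSign_mul_eq_abs (k := k) fun p hp h0 => by
    have := hkm p hp
    rw [h0, abs_zero] at this
    linarith
  have hkeq : ∀ q, k q = x q * |k q| := fun q => by
    rw [← hkx, mul_comm (k q), ← mul_assoc, hx q, one_mul]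
  have hka := fun q => abs_apply_le hk q
  -- `w` is `1 - |g|` away from `a`: within `d` of `1 - |k|`, and, when `n` is positive, in `[d, n *
  -- d]` at non-isolated points because `1 - |k| ≤ (n + 1) * d` there.
  let w : K → ℝ := fun q => max (1 - |k q| - d) (min (max (1 - |k q|) d) (n * d))
  have hw0 : ∀ q, 0 ≤ w q := fun q => le_max_of_le_right (le_min (le_max_of_le_right hd0) hnd0)
  have hw1 : ∀ q, w q ≤ 1 := fun q =>
    max_le (by linarith [abs_nonneg (k q)]) ((min_le_right _ _).trans hnd.le)
  have hwd : ∀ q, |1 - |k q| - w q| ≤ d := fun q => by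
    have h1 : w q ≤ 1 - |k q| + d := max_le (by linarith) ((min_le_left _ _).trans
      (max_le (by linarith) (by linarith [hka q])))
    have h2 : 1 - |k q| - d ≤ w q := le_max_left _ _
    rw [abs_le]; constructor <;> linarith
  let f : C(K, ℝ) := x * ⟨fun q => 1 - w q, by fun_prop⟩
  have hf : ∀ q, f q = x q * (1 - w q) := fun q => rfl
  let v := x a * min 1 (|k a| + d)
  let g := f.updateAt a ha v
  have hga : g a = v := ContinuousMap.updateAt_self _ _ _ _
  have hgq : ∀ q, q ≠ a → g q = x q * (1 - w q) := fun q hq =>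
    ContinuousMap.updateAt_of_ne _ _ _ hq
  have hgn : ‖g‖ ≤ 1 := (norm_le_iff_abs zero_le_one).2 fun q => by
    by_cases hq : q = a
    · rw [hq, hga, abs_mul, hx.abs, one_mul, abs_of_nonneg (by positivity)]
      exact min_le_left _ _
    · rw [hgq q hq, abs_mul, hx.abs, one_mul, abs_of_nonneg (by linarith [hw1 q])]
      linarith [hw0 q]
  have hgk : ∀ q, |k q - g q| ≤ d := fun q => by
    by_cases hq : q = a
    · have e : k a - g a = x a * (|k a| - min 1 (|k a| + d)) := by
        rw [mul_sub, ← hkeq a, hga]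
      rw [hq, e, abs_mul, hx.abs, one_mul, abs_le]
      have := hka a
      rcases min_cases 1 (|k a| + d) with h | h <;> rw [h.1] <;> constructor <;> linarith
    · have e : k q - g q = -(x q * (1 - |k q| - w q)) := by
        rw [hgq q hq]
        linear_combination hkeq q
      rw [e, abs_neg, abs_mul, hx.abs, one_mul]
      exact hwd q
  have hFg : F g = g := by
    refine hF (1 - n * d) g (by linarith) (by linarith) hgn fun p hp => ?_
    have hpa : p ≠ a := by rintro rfl; exact hp ha
    rw [hgq p hpa, abs_mul, hx.abs, one_mul, abs_of_nonneg (by linarith [hw1 p])]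
    have h1 : w p ≤ n * d := max_le (by linarith [hkm p hp]) (min_le_right _ _)
    refine ⟨by linarith, ?_⟩
    rcases Nat.eq_zero_or_pos n with h0 | h0
    · simp [h0]
    · have hn1 : (1 : ℝ) ≤ n := by exact_mod_cast h0
      have h2 : d ≤ w p := le_max_of_le_right (le_min (le_max_right _ _) (by nlinarith))
      nlinarith
  have h1 := H.abs_sub_le hk hgn hd0 hgk a
  rw [hFg, hga] at h1
  have h2 : |v| = min 1 (|k a| + d) := by
    simp only [v]
    rw [abs_mul, hx.abs, one_mul, abs_of_nonneg (by positivity)]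
  have h3 := abs_sub_abs_le_abs_sub v (F k a)
  rw [abs_sub_comm, h2] at h3
  rcases min_cases 1 (|k a| + d) with h | h <;> rw [h.1] at h3
  · exact (min_le_right _ _).trans (by linarith)
  · exact (min_le_left _ _).trans (by linarith)

/-- `k` is approximated by `h` with modulus below `1 - d` at all isolated points off a finite set.
There `min_abs_le_abs_map`, applied to `G f`, leaves only `|G f a| ≤ |f a|`, which is the slice
criterion. -/
theorem fixesLevel_succ (H : NonexpansiveFixingSigns F G)
    [TopologicalSpace.MetrizableSpace K] {n : ℕ}
    (hF : FixesLevel F n) : FixesLevel F (n + 1) := by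
  intro m k hm hm1 hk hkm
  have hn : (0 : ℝ) ≤ n := n.cast_nonneg
  set d : ℝ := (1 - m) / (n + 1) with hd
  have hdm : (n + 1) * d = 1 - m := by rw [hd]; field_simp
  have hd1 : d < 1 := by
    by_contra! h
    nlinarith
  have hkd : ∀ p, ¬ IsOpen ({p} : Set K) → |k p| ≤ 1 - d := fun p hp => by
    have := (hkm p hp).2
    rw [← hdm] at this
    push_cast at this
    have := le_of_mul_le_mul_left this (by positivity)
    linarith
  refine H.map_eq_of_approx hk fun η hη => ?_
  obtain ⟨x, hx, hkx, -⟩ := exists_isSign_mul_eq_abs (k := k) fun p hp h0 => by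
    have := (hkm p hp).1
    rw [h0, abs_zero] at this
    linarith
  have hkeq : ∀ q, k q = x q * |k q| := fun q => by
    rw [← hkx, mul_comm (k q), ← mul_assoc, hx q, one_mul]
  have hka := fun q => abs_apply_le hk q
  -- Metrizability supplies a function vanishing exactly on the non-isolated points; it makes the
  -- bound `1 - d` strict at isolated points without moving `k` elsewhere.
  obtain ⟨ρ, hρ0, hρp, hρ1⟩ : ∃ ρ : C(K, ℝ), (∀ p, ¬ IsOpen ({p} : Set K) → ρ p = 0) ∧
      (∀ p, IsOpen ({p} : Set K) → 0 < ρ p) ∧ ∀ q, 0 ≤ ρ q ∧ ρ q ≤ 1 := by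
    let _ := TopologicalSpace.metrizableSpaceMetric K
    rcases eq_empty_or_nonempty {p : K | ¬ IsOpen ({p} : Set K)} with he | hne
    · exact ⟨1, fun p hp => absurd hp (eq_empty_iff_forall_notMem.1 he p), fun _ _ => by simp,
        fun _ => by simp⟩
    · have hcl := H.finite_nonisolated.isClosed
      refine ⟨⟨fun q => min 1 (Metric.infDist q {p : K | ¬ IsOpen ({p} : Set K)}),
        continuous_const.min (Metric.continuous_infDist_pt _)⟩, fun p hp => ?_, fun p hp => ?_,
        fun q => ⟨le_min zero_le_one Metric.infDist_nonneg, min_le_left _ _⟩⟩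
      · simp only [ContinuousMap.coe_mk]
        rw [Metric.infDist_zero_of_mem hp]
        simp
      · refine lt_min zero_lt_one ((hcl.notMem_iff_infDist_pos hne).1 fun h => h hp)
  set η' := η / 2 with hη'
  have hη'0 : 0 < η' := half_pos hη
  -- The excess of `|k|` over `1 - d` is removed up to `η'`, then `η' * ρ` is subtracted; the total
  -- loss is at most `η`.
  let t : K → ℝ := fun q => max 0 (|k q| - min (max (|k q| - (1 - d)) 0) η' - η' * ρ q)
  let h : C(K, ℝ) := x * ⟨t, by fun_prop⟩
  have ht0 : ∀ q, 0 ≤ t q := fun q => le_max_left _ _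
  have htk : ∀ q, t q ≤ |k q| := fun q => max_le (abs_nonneg _) (by
    have h1 : 0 ≤ min (max (|k q| - (1 - d)) 0) η' := le_min (le_max_right _ _) hη'0.le
    have h2 := mul_nonneg hη'0.le (hρ1 q).1
    linarith)
  have htη : ∀ q, |k q| - η ≤ t q := fun q => by
    have h1 : min (max (|k q| - (1 - d)) 0) η' ≤ η' := min_le_right _ _
    have h2 := mul_le_mul_of_nonneg_left (hρ1 q).2 hη'0.le
    refine le_trans ?_ (le_max_right _ _)
    linarith
  have hh : ∀ q, h q = x q * t q := fun q => rfl
  have habs : ∀ q, |h q| = t q := fun q => by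
    rw [hh, abs_mul, hx.abs, one_mul, abs_of_nonneg (ht0 q)]
  have hhn : ‖h‖ ≤ 1 := (norm_le_iff_abs zero_le_one).2 fun q => by
    rw [habs]; exact (htk q).trans (hka q)
  refine ⟨h, ⟨hhn, H.map_eq_of_inv_eq hhn ?_⟩, ?_⟩
  · have hcl : IsClosed {q | 1 - d + η' ≤ |k q|} := isClosed_le continuous_const (by fun_prop)
    have hSI : ∀ a ∈ {q | 1 - d + η' ≤ |k q|}, IsOpen ({a} : Set K) := fun a ha => by
      by_contra hna
      have := hkd a hna
      simp only [mem_ofPred_eq] at ha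
      linarith
    have hhm : ∀ p, ¬ IsOpen ({p} : Set K) → m ≤ |h p| := fun p hp => by
      rw [habs]
      refine le_trans (hkm p hp).1 (le_trans ?_ (le_max_right _ _))
      rw [hρ0 p hp, max_eq_right (by linarith [hkd p hp]), min_eq_left hη'0.le]
      linarith
    refine H.inv_eq_of_slice_abs hhn (finite_of_isClosed_of_isolated hcl hSI)
      fun f hf hfS a haS ha => ?_
    have hlt : |f a| < 1 - d := by
      rw [hfS a haS, habs]
      simp only [mem_ofPred_eq, not_le] at haS
      have hρa := mul_pos hη'0 (hρp a ha)
      refine max_lt (by linarith) ?_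
      rcases le_total (|k a| - (1 - d)) 0 with h1 | h1
      · rw [max_eq_right h1, min_eq_left hη'0.le]
        linarith
      · rw [max_eq_left h1, min_eq_left (by linarith)]
        linarith
    have hGm : ∀ p, ¬ IsOpen ({p} : Set K) → m ≤ |G f p| := fun p hp => by
      have h1 := (H.abs_le_abs_inv hf p).2
      rw [hfS p fun hpS => hp (hSI p hpS)] at h1
      exact (hhm p hp).trans h1
    have := H.min_abs_le_abs_map hF hm hm1 hdm (H.norm_inv f hf) hGm ha
    rw [H.map_inv f hf] at this
    rcases min_le_iff.1 this with h1 | h1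
    · exact h1
    · linarith
  · rw [norm_sub_le_iff_abs hη.le]
    intro q
    have e : h q - k q = x q * (t q - |k q|) := by
      rw [mul_sub, ← hkeq q, hh]
    rw [e, abs_mul, hx.abs, one_mul, abs_le]
    constructor <;> linarith [htk q, htη q]

/-- A non-expansive bijection of the ball that fixes the sign functions is the identity. -/
theorem map_eq_self (H : NonexpansiveFixingSigns F G)
    [TopologicalSpace.MetrizableSpace K] {k : C(K, ℝ)} (hk : ‖k‖ ≤ 1) : F k = k := by
  have hall : ∀ n, FixesLevel F n := fun n => by
    induction n with
    | zero => exact H.fixesLevel_zero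
    | succ n ih => exact H.fixesLevel_succ ih
  refine H.map_eq_of_approx hk fun η hη => ?_
  obtain ⟨f, ⟨hf1, hf0⟩, hfk⟩ := exists_nonvanishing_norm_sub_le H.finite_nonisolated hk hη
  refine ⟨f, ⟨hf1.le, ?_⟩, hfk⟩
  obtain ⟨m, hm, hm1, hmf⟩ := exists_pos_le_abs H.finite_nonisolated hf0
  -- This `n` gives `1 - m ≤ 1 ≤ n * (1 - ‖f‖)`.
  obtain ⟨n, hn⟩ := exists_nat_ge (1 / (1 - ‖f‖))
  refine hall n m f hm hm1 hf1.le fun p hp => ⟨hmf p hp, ?_⟩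
  have h1 : 1 ≤ n * (1 - ‖f‖) := (div_le_iff₀ (by linarith)).1 hn
  have h2 : |f p| ≤ ‖f‖ := abs_apply_le le_rfl p
  have h3 : (0 : ℝ) ≤ n := n.cast_nonneg
  nlinarith

end NonexpansiveFixingSigns

/-! ### Reduction to fixed sign functions and conclusion -/

/-- A non-expansive bijection of the ball of `C(K, ℝ)`, where `K` is a compact metrizable space
with finitely many non-isolated points, preserves distances. -/
theorem NonexpansiveBij.norm_map_sub_map {K : Type*} [TopologicalSpace K] [CompactSpace K]
    [TopologicalSpace.MetrizableSpace K] {F G : C(K, ℝ) → C(K, ℝ)}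
    (H : NonexpansiveBij F G) (hfin : {p : K | ¬ IsOpen ({p} : Set K)}.Finite) {f g : C(K, ℝ)}
    (hf : ‖f‖ ≤ 1) (hg : ‖g‖ ≤ 1) : ‖F f - F g‖ = ‖f - g‖ := by
  have hd := dense_isolated hfin
  obtain ⟨τ, hτ⟩ := H.exists_perm_inv_apply hd
  have hx1 := H.isSign_inv isSign_one
  set ε := G 1 with hε
  choose C hC using exists_eq_comp_perm hfin τ fun x hx => ⟨ε * G x, fun b => by
    rw [ContinuousMap.mul_apply, hτ x hx, ← mul_assoc, hx1 b, one_mul]⟩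
  -- Continuity of composition with `τ.symm` needs every sign function to have the form `ε * G y`;
  -- this is where surjectivity of `G` enters.
  choose D hD using exists_eq_comp_perm hfin τ.symm fun x hx => by
    obtain ⟨y, hy, e⟩ := H.exists_inv_eq hfin (hx1.mul hx)
    refine ⟨y, fun a => ?_⟩
    have := hτ y hy (τ.symm a)
    rw [e, τ.apply_symm_apply, ContinuousMap.mul_apply] at this
    refine (mul_left_cancel₀ (fun h => ?_) this).symm
    simpa [h] using hx1 (τ.symm a)
  let T : C(K, ℝ) → C(K, ℝ) := fun k => ε * C k
  let S : C(K, ℝ) → C(K, ℝ) := fun k => D (ε * k)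
  have hT : ∀ k (b : {a : K // IsOpen ({a} : Set K)}), T k b = ε b * k (τ b) := fun k b => by
    simp [T, hC]
  have hS : ∀ k (a : {a : K // IsOpen ({a} : Set K)}),
      S k a = ε (τ.symm a) * k (τ.symm a) := fun k a => by
    simp [S, hD]
  have hTS : ∀ k, T (S k) = k := fun k => eq_of_dense_eq hd fun a ha => by
    rw [hT _ ⟨a, ha⟩, hS, τ.symm_apply_apply, ← mul_assoc, hx1, one_mul]
  have hST : ∀ k, S (T k) = k := fun k => eq_of_dense_eq hd fun a ha => by
    rw [hS _ ⟨a, ha⟩, hT, τ.apply_symm_apply, ← mul_assoc, hx1, one_mul]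
  have hTd : ∀ k l, ‖T k - T l‖ ≤ ‖k - l‖ := fun k l =>
    norm_le_of_dense hd (norm_nonneg _) fun a ha => by
      rw [ContinuousMap.sub_apply, hT _ ⟨a, ha⟩, hT _ ⟨a, ha⟩, ← mul_sub, abs_mul, hx1.abs, one_mul]
      exact abs_sub_apply_le le_rfl _
  have hSd : ∀ k l, ‖S k - S l‖ ≤ ‖k - l‖ := fun k l =>
    norm_le_of_dense hd (norm_nonneg _) fun a ha => by
      rw [ContinuousMap.sub_apply, hS _ ⟨a, ha⟩, hS _ ⟨a, ha⟩, ← mul_sub, abs_mul, hx1.abs, one_mul]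
      exact abs_sub_apply_le le_rfl _
  have hT0 : T 0 = 0 := eq_of_dense_eq hd fun a ha => by rw [hT _ ⟨a, ha⟩]; simp
  have hS0 : S 0 = 0 := eq_of_dense_eq hd fun a ha => by rw [hS _ ⟨a, ha⟩]; simp
  have hTn : ∀ k, ‖k‖ ≤ 1 → ‖T k‖ ≤ 1 := fun k hk => by
    have := hTd k 0
    rw [hT0, sub_zero, sub_zero] at this
    exact this.trans hk
  have hSn : ∀ k, ‖k‖ ≤ 1 → ‖S k‖ ≤ 1 := fun k hk => by
    have := hSd k 0
    rw [hS0, sub_zero, sub_zero] at this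
    exact this.trans hk
  -- `T` agrees with `G` on sign functions, so `F ∘ T` fixes them.
  have HV : NonexpansiveFixingSigns (fun k => F (T k)) (fun k => S (G k)) :=
    { norm_map := fun k hk => H.norm_map _ (hTn k hk)
      norm_inv := fun k hk => hSn _ (H.norm_inv k hk)
      map_inv := fun k hk => by simp only [hTS, H.map_inv k hk]
      inv_map := fun k hk => by simp only [H.inv_map _ (hTn k hk), hST]
      dist_le := fun k l hk hl => (H.dist_le _ _ (hTn k hk) (hTn l hl)).trans (hTd k l)
      map_sign := fun x hx => by
        have : T x = G x := eq_of_dense_eq hd fun a ha => by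
          rw [hT _ ⟨a, ha⟩, hτ x hx ⟨a, ha⟩]
        simp only [this, H.map_inv x hx.norm_le]
      finite_nonisolated := hfin }
  have hFS : ∀ k, ‖k‖ ≤ 1 → F k = S k := fun k hk => by
    have := HV.map_eq_self (hSn k hk)
    simpa only [hTS] using this
  refine le_antisymm (H.dist_le f g hf hg) ?_
  have := hTd (S f) (S g)
  rwa [hTS, hTS, ← hFS f hf, ← hFS g hg] at this

theorem theorem1p1 (K : Type*) [TopologicalSpace K] [CompactSpace K]
    [TopologicalSpace.MetrizableSpace K]
    (hK : (derivedSet (Set.univ : Set K)).Finite) :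
    IsPlastic (Metric.closedBall (0 : C(K, ℝ)) 1) := by
  have hfin : {p : K | ¬ IsOpen ({p} : Set K)}.Finite := by
    refine hK.subset fun p hp => ?_
    rw [mem_derivedSet, accPt_iff_frequently_nhdsNE]
    simp only [mem_univ, frequently_true_iff_neBot]
    rw [mem_ofPred_eq, isOpen_singleton_iff_punctured_nhds] at hp
    exact ⟨hp⟩
  intro Φ hL hB
  obtain ⟨Ψ, hΨ1, hΨ2⟩ := Function.bijective_iff_has_inverse.1 hB
  have hmem : ∀ f : C(K, ℝ), ‖f‖ ≤ 1 → f ∈ Metric.closedBall (0 : C(K, ℝ)) 1 := fun f hf => by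
    simpa using hf
  have hnorm : ∀ f : Metric.closedBall (0 : C(K, ℝ)) 1, ‖(f : C(K, ℝ))‖ ≤ 1 := fun f =>
    mem_closedBall_zero_iff.1 f.2
  -- The values outside the ball are irrelevant.
  let F : C(K, ℝ) → C(K, ℝ) := fun f => if h : ‖f‖ ≤ 1 then Φ ⟨f, hmem f h⟩ else f
  let G : C(K, ℝ) → C(K, ℝ) := fun f => if h : ‖f‖ ≤ 1 then Ψ ⟨f, hmem f h⟩ else f
  have hF : ∀ f (h : ‖f‖ ≤ 1), F f = Φ ⟨f, hmem f h⟩ := fun f h => dif_pos h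
  have hG : ∀ f (h : ‖f‖ ≤ 1), G f = Ψ ⟨f, hmem f h⟩ := fun f h => dif_pos h
  have H : NonexpansiveBij F G :=
    { norm_map := fun f h => by rw [hF f h]; exact hnorm _
      norm_inv := fun f h => by rw [hG f h]; exact hnorm _
      map_inv := fun f h => by
        rw [hG f h, hF _ (hnorm _)]
        exact congrArg Subtype.val (hΨ2 ⟨f, hmem f h⟩)
      inv_map := fun f h => by
        rw [hF f h, hG _ (hnorm _)]
        exact congrArg Subtype.val (hΨ1 ⟨f, hmem f h⟩)
      dist_le := fun f g hf hg => by
        rw [hF f hf, hF g hg, ← dist_eq_norm, ← dist_eq_norm]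
        have := hL.dist_le_mul ⟨f, hmem f hf⟩ ⟨g, hmem g hg⟩
        rwa [NNReal.coe_one, one_mul] at this }
  refine Isometry.of_dist_eq fun f g => ?_
  have := H.norm_map_sub_map hfin (hnorm f) (hnorm g)
  rw [hF f (hnorm f), hF g (hnorm g), ← dist_eq_norm, ← dist_eq_norm] at this
  exact this
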